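/- **Six-vertex LGV Lemma.** Let $R$ be a commutative ring, $N\ge 0$, and let $x_i,y_i,A_i,B_i\in R$ $(1\le i\le N)$ be row parameters; for the dual model $\mathfrak{S}^*$ the $A_i,B_i$ are assumed invertible. *The models.* A state is an assignment of spins $+$ or $-$ to all edges of a rectangular grid with $N$ rows and $M$ columns, the columns being labelled $0,\ldots,M-1$ from left to right. Describe a vertex by its four spins (left, top, right, bottom). In row $i$, the nonzero Boltzmann weights of $\mathfrak{S}$ are $$(+,+,+,+)\mapsto A_i,\quad (-,-,-,-)\mapsto y_iA_iB_i,\quad (+,-,+,-)\mapsto A_iB_i,$$ $$(-,+,-,+)\mapsto x_iA_i,\quad (-,+,+,-)\mapsto (x_i+y_i)A_iB_i,\quad (+,-,-,+)\mapsto A_i,$$ and those of $\mathfrak{S}^*$ are $$(+,+,+,+)\mapsto A_i^{-1},\quad (-,-,-,-)\mapsto x_iA_i^{-1}B_i^{-1},\quad (+,-,+,-)\mapsto A_i^{-1}B_i^{-1},$$ $$(-,+,-,+)\mapsto y_iA_i^{-1},\quad (+,+,-,-)\mapsto (x_i+y_i)A_i^{-1},\quad (-,-,+,+)\mapsto A_i^{-1}B_i^{-1};$$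 all other vertices have weight $0$. For finite sequences $\lambda,\mu$ of distinct nonnegative integers smaller than $M$, the model $\mathfrak{S}_{\lambda/\mu}$ has rows labelled $1,\ldots,N$ from bottom to top, all left and right boundary edges equal to $+$, bottom boundary edges $-$ exactly in the columns labelled by parts of $\lambda$, and top boundary edges $-$ exactly in the columns labelled by parts of $\mu$. The model $\mathfrak{S}^*_{\lambda/\mu}$ is defined in the same way with the $\mathfrak{S}^*$ weights, but with rows labelled from top to bottom, $\lambda$ on the top boundary and $\mu$ on the bottom boundary. The partition function $Z$ of a model is the sum, over all states with the given boundary spins, of the product of the Boltzmann weights of all vertices. *Statement.* Let $\lambda=(\lambda_1>\cdots>\lambda_\ell\ge 0)$ and $\mu=(\mu_1>\cdots>\mu_\ell\ge 0)$ be strict partitions of the same length $\ell=\ell(\lambda)=\ell(\mu)$ (a part may be $0$). Then $$Z(\mathfrak{S}_{\lambda/\mu})=\det_{1\le i,j\le \ell} Z(\mathfrak{S}_{(\lambda_i)/(\mu_j)})\qquad\text{and}\qquad Z(\mathfrak{S}^*_{\lambda/\mu})=\det_{1\le i,j\le \ell} Z(\mathfrak{S}^*_{(\lambda_i)/(\mu_j)}),$$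 where all models have the same $N$ rows with the same row parameters, the models on the left side have $M$ columns, the model in entry $(i,j)$ on the right side has $M_{ij}>\max(\lambda_i,\mu_j)$ columns, and these numbers satisfy $M=\sum_{i=1}^{\ell} M_{i,\sigma(i)}$ for all permutations $\sigma$ of $\{1,\ldots,\ell\}$. -/

import Mathlib

namespace SixVertex

/-- The two spins of the six-vertex model; `minus` marks the presence of a particle. -/
inductive Spin : Type
  | plus : Spin
  | minus : Spin
  deriving DecidableEq

instance : Fintype Spin where
  elems := {.plus, .minus}
  complete := by intro s; cases s <;> decide

/-- The Boltzmann weights of the model `𝔖` in a row with parameters `x, y, A, B`, as a function of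
the spins on the left (west), top (north), right (east) and bottom (south) edge of a vertex.
The six admissible vertices are listed in the order `a₁, a₂, b₁, b₂, c₁, c₂`;
all other vertices have weight zero. -/
def weight {R : Type*} [CommRing R] (x y A B : R) (west north east south : Spin) : R :=
  match west, north, east, south with
  | .plus, .plus, .plus, .plus => A
  | .minus, .minus, .minus, .minus => y * A * B
  | .plus, .minus, .plus, .minus => A * B
  | .minus, .plus, .minus, .plus => x * A
  | .minus, .plus, .plus, .minus => (x + y) * A * B
  | .plus, .minus, .minus, .plus => A
  | _, _, _, _ => 0

/-- The Boltzmann weights of the dual model `𝔖*`, with the same conventions; the parameters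
`A, B` have to be invertible. -/
def weightStar {R : Type*} [CommRing R] (x y : R) (A B : Rˣ)
    (west north east south : Spin) : R :=
  match west, north, east, south with
  | .plus, .plus, .plus, .plus => (↑A⁻¹ : R)
  | .minus, .minus, .minus, .minus => x * (↑A⁻¹ : R) * (↑B⁻¹ : R)
  | .plus, .minus, .plus, .minus => (↑A⁻¹ : R) * (↑B⁻¹ : R)
  | .minus, .plus, .minus, .plus => y * (↑A⁻¹ : R)
  | .plus, .plus, .minus, .minus => (x + y) * (↑A⁻¹ : R)
  | .minus, .minus, .plus, .plus => (↑A⁻¹ : R) * (↑B⁻¹ : R)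
  | _, _, _, _ => 0

/-- An assignment of spins to all edges of a rectangular grid with `N` rows and `m` columns.
The columns are labelled `0, …, m - 1` from left to right. The rows are labelled `0, …, N - 1`,
from bottom to top in `𝔖` and from top to bottom in `𝔖*`.

* `s.1 k c` is the spin of the vertical edge in column `c` that precedes row `k` (and follows
  row `k - 1`) in the order of the row labels; so `k = 0` and `k = N` are boundary edges.
* `s.2 i c` is the spin of the horizontal edge in row `i` directly to the left of column `c`
  (and to the right of column `c - 1`); so `c = 0` and `c = m` are boundary edges. -/
abbrev Config (N m : ℕ) : Type :=
  (Fin (N + 1) → Fin m → Spin) × (Fin N → Fin (m + 1) → Spin)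

/-- The boundary spins given by a sequence of parts: `-` on the columns labelled by a part,
and `+` on all other columns. -/
def boundarySpin {ℓ : ℕ} (m : ℕ) (part : Fin ℓ → ℕ) (c : Fin m) : Spin :=
  if ∃ i, part i = (c : ℕ) then .minus else .plus

/-- The boundary conditions of `𝔖_{λ/μ}` (bottom `λ`, top `μ`) and of `𝔖*_{λ/μ}`
(top `λ`, bottom `μ`): in both cases `λ` bounds the first row and `μ` bounds the last one.
The left and right boundary edges are all `+`. -/
def HasBoundary {N m ℓ k : ℕ} (lam : Fin ℓ → ℕ) (mu : Fin k → ℕ) (s : Config N m) : Prop :=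
  s.1 0 = boundarySpin m lam ∧ s.1 (Fin.last N) = boundarySpin m mu ∧
    ∀ i, s.2 i 0 = .plus ∧ s.2 i (Fin.last m) = .plus

instance {N m ℓ k : ℕ} (lam : Fin ℓ → ℕ) (mu : Fin k → ℕ) :
    DecidablePred (HasBoundary (N := N) (m := m) lam mu) :=
  fun s => by unfold HasBoundary; infer_instance

/-- The partition function `Z(𝔖_{λ/μ}(x; y; A; B))` of the model with `N` rows and `m` columns.
Rows go from bottom to top, so row `i` has the vertical edges `i` below it and `i + 1` above it. -/
def Z {R : Type*} [CommRing R] {N ℓ k : ℕ} (x y A B : Fin N → R)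
    (m : ℕ) (lam : Fin ℓ → ℕ) (mu : Fin k → ℕ) : R :=
  ∑ s : Config N m with HasBoundary lam mu s, ∏ i : Fin N, ∏ c : Fin m,
    weight (x i) (y i) (A i) (B i)
      (west := s.2 i c.castSucc) (north := s.1 i.succ c)
      (east := s.2 i c.succ) (south := s.1 i.castSucc c)

/-- The partition function `Z(𝔖*_{λ/μ}(x; y; A; B))` of the model with `N` rows and `m` columns.
Rows go from top to bottom, so row `i` has the vertical edges `i` above it and `i + 1` below it. -/
def ZStar {R : Type*} [CommRing R] {N ℓ k : ℕ} (x y : Fin N → R) (A B : Fin N → Rˣ)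
    (m : ℕ) (lam : Fin ℓ → ℕ) (mu : Fin k → ℕ) : R :=
  ∑ s : Config N m with HasBoundary lam mu s, ∏ i : Fin N, ∏ c : Fin m,
    weightStar (x i) (y i) (A i) (B i)
      (west := s.2 i c.castSucc) (north := s.1 i.castSucc c)
      (east := s.2 i c.succ) (south := s.1 i.succ c)

end SixVertex

namespace SixVertex

variable {R : Type*} [CommRing R]

/-! Read the spins `-` on a row of vertical edges as a wedge of basis vectors. Both families of
weights satisfy the free fermion condition `a₁ * a₂ + b₁ * b₂ = c₁ * c₂`. Under this condition a row
with `M` columns and outer edges `+` acts as `a ^ M` times the exterior power of a one-particle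
operator `transfer` that does not depend on `M` (`FreeFermion.sum_row_smul_wedge`). Composing rows
keeps this form, and matrix coefficients of an exterior power are minors (`partition_boundarySpin`).
The entries of the determinant are the `1 × 1` minors; the condition on the numbers of columns makes
the powers of the `a`'s agree in every term of the Leibniz expansion. -/

theorem sum_spin {G : Type*} [AddCommMonoid G] (f : Spin → G) :
    ∑ s, f s = f .plus + f .minus := by
  have : (Finset.univ : Finset Spin) = {.plus, .minus} := rfl
  rw [this, Finset.sum_pair (by decide)]

/-! ### One row as an operator on the exterior algebra -/

/-- Parameters of free-fermionic six-vertex weights with common factor `a`; the weight `a₂` is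
determined by the free fermion condition. -/
structure FreeFermion (R : Type*) where
  (a b₁ b₂ c₁ c₂ : R)

namespace FreeFermion

/-- The weight of a vertex, as a function of the spins on the left edge, on the vertical edge on
the side of the first row, on the right edge, and on the other vertical edge. -/
def vertex (p : FreeFermion R) (west inc east out : Spin) : R :=
  match west, inc, east, out with
  | .plus, .plus, .plus, .plus => p.a
  | .minus, .minus, .minus, .minus => p.a * (p.c₁ * p.c₂ - p.b₁ * p.b₂)
  | .plus, .minus, .plus, .minus => p.a * p.b₁
  | .minus, .plus, .minus, .plus => p.a * p.b₂
  | .minus, .minus, .plus, .plus => p.a * p.c₁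
  | .plus, .plus, .minus, .minus => p.a * p.c₂
  | _, _, _, _ => 0

/-- The partition function of a row with `+` on its left edge and `h` on its right edge. -/
def row (p : FreeFermion R) (M : ℕ) (h : Spin) (S U : Fin M → Spin) : R :=
  ∑ g : Fin (M + 1) → Spin, if g 0 = .plus ∧ g (Fin.last M) = h then
    ∏ c : Fin M, p.vertex (g c.castSucc) (S c) (g c.succ) (U c) else 0

theorem row_zero (p : FreeFermion R) (h : Spin) (S U : Fin 0 → Spin) :
    p.row 0 h S U = if h = .plus then 1 else 0 := by
  rw [row, ← (Equiv.funUnique (Fin 1) Spin).symm.sum_comp, sum_spin]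
  cases h <;> simp

theorem row_succ (p : FreeFermion R) (M : ℕ) (h : Spin) (S U : Fin (M + 1) → Spin) :
    p.row (M + 1) h S U = ∑ h', p.row M h' (fun c => S c.castSucc) (fun c => U c.castSucc) *
      p.vertex h' (S (Fin.last M)) h (U (Fin.last M)) := by
  rw [row, ← (Fin.snocEquiv fun _ => Spin).sum_comp, Fintype.sum_prod_type]
  simp only [row, Finset.sum_mul]
  rw [Finset.sum_comm, Finset.sum_comm (s := (Finset.univ : Finset Spin))]
  refine Finset.sum_congr rfl fun g _ => ?_
  have key : ∀ k : Spin, (∏ c : Fin (M + 1), p.vertex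
      ((Fin.snoc g k : Fin (M + 2) → Spin) c.castSucc) (S c)
      ((Fin.snoc g k : Fin (M + 2) → Spin) c.succ) (U c)) =
      (∏ c : Fin M, p.vertex (g c.castSucc) (S c.castSucc) (g c.succ) (U c.castSucc)) *
        p.vertex (g (Fin.last M)) (S (Fin.last M)) k (U (Fin.last M)) := by
    intro k
    rw [Fin.prod_univ_castSucc]
    simp only [Fin.succ_castSucc, Fin.snoc_castSucc (α := fun _ => Spin), Fin.succ_last,
      Fin.snoc_last (α := fun _ => Spin)]
  have h0 : ∀ k : Spin, (Fin.snoc g k : Fin (M + 2) → Spin) 0 = g 0 := fun k =>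
    Fin.snoc_castSucc (α := fun _ => Spin) k g 0
  simp only [Fin.snocEquiv, Equiv.coe_fn_mk, key, h0, Fin.snoc_last (α := fun _ => Spin)]
  by_cases hg : g 0 = .plus
  · simp [hg, ite_mul]
  · simp [hg]

/-- The image of a particle entering a row from the right of column `M - 1`. -/
noncomputable def tail (p : FreeFermion R) : ℕ → ℕ →₀ R
  | 0 => 0
  | M + 1 => p.b₂ • p.tail M + p.c₂ • Finsupp.single M 1

/-- The one-particle transfer operator of a row. -/
noncomputable def transfer (p : FreeFermion R) : (ℕ →₀ R) →ₗ[R] (ℕ →₀ R) :=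
  Finsupp.linearCombination R fun M => p.b₁ • Finsupp.single M 1 + p.c₁ • p.tail M

theorem transfer_single (p : FreeFermion R) (M : ℕ) :
    p.transfer (Finsupp.single M 1) = p.b₁ • Finsupp.single M 1 + p.c₁ • p.tail M := by
  simp [transfer]

/-- The factor of a particle that enters a row from the right, if there is one. -/
noncomputable def entering (p : FreeFermion R) (M : ℕ) : Spin → ExteriorAlgebra R (ℕ →₀ R)
  | .plus => 1
  | .minus => ExteriorAlgebra.ι R (p.tail M)

end FreeFermion

variable (R) in
/-- The wedge product of the basis vectors of the columns with spin `-`, from right to left. -/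
noncomputable def wedge : (M : ℕ) → (Fin M → Spin) → ExteriorAlgebra R (ℕ →₀ R)
  | 0, _ => 1
  | M + 1, S => (if S (Fin.last M) = .minus then
      ExteriorAlgebra.ι R (Finsupp.single M 1) else 1) * wedge M fun c => S c.castSucc

theorem sum_snoc {M : ℕ} {G : Type*} [AddCommMonoid G] (f : (Fin (M + 1) → Spin) → G) :
    ∑ U, f U = ∑ U : Fin M → Spin, (f (Fin.snoc U .plus) + f (Fin.snoc U .minus)) := by
  rw [← (Fin.snocEquiv fun _ => Spin).sum_comp, Fintype.sum_prod_type_right]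
  simp only [sum_spin, Fin.snocEquiv, Equiv.coe_fn_mk]

/-- Only `h = .plus` is needed later, but the induction removes the last column, whose left edge can
carry either spin. A particle on the right edge moves left until it turns into a column, which
contributes the factor `tail M`. -/
theorem FreeFermion.sum_row_smul_wedge (p : FreeFermion R) (M : ℕ) (h : Spin)
    (S : Fin M → Spin) :
    ∑ U, p.row M h S U • wedge R M U =
      p.a ^ M • (p.entering M h * ExteriorAlgebra.map p.transfer (wedge R M S)) := by
  induction M generalizing h with
  | zero => cases h <;> simp [row_zero, wedge, entering, tail]
  | succ M ih =>
    have ihp := ih .plus fun c => S c.castSucc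
    have ihm := ih .minus fun c => S c.castSucc
    set W := ExteriorAlgebra.map p.transfer (wedge R M fun c => S c.castSucc) with hW
    set e := ExteriorAlgebra.ι R (Finsupp.single M (1 : R)) with he
    set v := ExteriorAlgebra.ι R (p.tail M)
    have hsum : ∑ U, p.row (M + 1) h S U • wedge R (M + 1) U =
        (p.vertex .plus (S (Fin.last M)) h .plus • p.a ^ M • W +
          p.vertex .minus (S (Fin.last M)) h .plus • p.a ^ M • (v * W)) +
        (p.vertex .plus (S (Fin.last M)) h .minus • p.a ^ M • (e * W) +
          p.vertex .minus (S (Fin.last M)) h .minus • p.a ^ M • (e * (v * W))) := by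
      have ihp' : ∑ U, p.row M .plus (fun c => S c.castSucc) U • wedge R M U = p.a ^ M • W := by
        rw [ihp]; simp [entering]
      have ihm' : ∑ U, p.row M .minus (fun c => S c.castSucc) U • wedge R M U =
          p.a ^ M • (v * W) := ihm
      rw [← mul_smul_comm _ e W, ← mul_smul_comm _ e (v * W), ← ihp', ← ihm', sum_snoc, Finset.mul_sum,
        Finset.mul_sum]
      simp only [Finset.smul_sum, ← Finset.sum_add_distrib]
      refine Finset.sum_congr rfl fun U _ => ?_
      simp only [row_succ, sum_spin, wedge, Fin.snoc_castSucc (α := fun _ => Spin),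
        Fin.snoc_last (α := fun _ => Spin), ← he, reduceCtorEq, if_true, if_false, one_mul,
        add_smul, mul_smul_comm, smul_smul, mul_comm]
    have hve : v * e = -(e * v) := by
      rw [eq_neg_iff_add_eq_zero]; exact ExteriorAlgebra.ι_add_mul_swap _ _
    have hee : e * e = 0 := ExteriorAlgebra.ι_sq_zero _
    have hvv : v * v = 0 := ExteriorAlgebra.ι_sq_zero _
    have hmap : ExteriorAlgebra.map p.transfer e = p.b₁ • e + p.c₁ • v := by
      rw [he, ExteriorAlgebra.map_apply_ι, transfer_single, map_add, map_smul, map_smul]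
    have htail : ExteriorAlgebra.ι R (p.tail (M + 1)) = p.b₂ • v + p.c₂ • e := by
      rw [tail, map_add, map_smul, map_smul]
    rw [hsum, wedge, map_mul, ← hW]
    -- The case with both spins `-` is where free fermions enter: `(b₂ v + c₂ e)(b₁ e + c₁ v) = (c₁
    -- c₂ - b₁ b₂) e v`.
    cases hS : S (Fin.last M) <;> cases h <;>
      simp only [vertex, entering, reduceCtorEq, if_true, if_false, map_one, one_mul, zero_smul,
        zero_add, add_zero, ← he, hmap, htail, add_mul, mul_add, smul_mul_assoc, mul_smul_comm,
        smul_add, smul_smul, ← mul_assoc, hve, hee, hvv, neg_mul, smul_neg, smul_zero, zero_mul]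
    all_goals module

/-! ### Composition of rows -/

/-- The partition function of a model with arbitrary vertical boundary spins. -/
def partition {N : ℕ} (p : Fin N → FreeFermion R) (M : ℕ) (S U : Fin M → Spin) : R :=
  ∑ v : Fin (N + 1) → Fin M → Spin, if v 0 = S ∧ v (Fin.last N) = U then
    ∏ i, (p i).row M .plus (v i.castSucc) (v i.succ) else 0

theorem partition_zero (p : Fin 0 → FreeFermion R) (M : ℕ) (S U : Fin M → Spin) :
    partition p M S U = if S = U then 1 else 0 := by
  rw [partition, ← (Equiv.funUnique (Fin 1) (Fin M → Spin)).symm.sum_comp,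
    Finset.sum_eq_single S]
  · simp
  · intro T _ hT
    simp [hT]
  · simp

theorem partition_succ {N : ℕ} (p : Fin (N + 1) → FreeFermion R) (M : ℕ) (S U : Fin M → Spin) :
    partition p M S U =
      ∑ T, (p 0).row M .plus S T * partition (fun i => p i.succ) M T U := by
  rw [partition, ← (Fin.consEquiv fun _ => Fin M → Spin).sum_comp, Fintype.sum_prod_type,
    Finset.sum_eq_single S]
  · simp only [partition, Finset.mul_sum]
    rw [Finset.sum_comm]
    refine Finset.sum_congr rfl fun v _ => ?_
    rw [Finset.sum_eq_single (v 0)]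
    · simp [Fin.consEquiv, Fin.prod_univ_succ, ← Fin.succ_last]
    · intro T _ hT
      simp [hT.symm]
    · simp
  · intro T _ hT
    simp [Fin.consEquiv, hT]
  · simp

/-- The one-particle transfer operator of several rows. -/
noncomputable def transfers : {N : ℕ} → (Fin N → FreeFermion R) → (ℕ →₀ R) →ₗ[R] (ℕ →₀ R)
  | 0, _ => LinearMap.id
  | _ + 1, p => transfers (fun i => p i.succ) ∘ₗ (p 0).transfer

/-- Functoriality of the exterior algebra turns composition of rows into composition of one-particle
operators. -/
theorem sum_partition_smul_wedge {N : ℕ} (p : Fin N → FreeFermion R) (M : ℕ)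
    (S : Fin M → Spin) :
    ∑ U, partition p M S U • wedge R M U =
      (∏ i, (p i).a) ^ M • ExteriorAlgebra.map (transfers p) (wedge R M S) := by
  induction N generalizing S with
  | zero => simp [partition_zero, transfers, ite_smul]
  | succ N ih =>
    have hrow := congrArg (ExteriorAlgebra.map (transfers fun i => p i.succ))
      ((p 0).sum_row_smul_wedge M .plus S)
    simp only [map_sum, map_smul, FreeFermion.entering, one_mul] at hrow
    rw [transfers, ← ExteriorAlgebra.map_comp_map, AlgHom.comp_apply, Fin.prod_univ_succ,
      mul_comm, mul_pow, mul_smul, ← hrow]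
    simp only [partition_succ, Finset.sum_smul, Finset.smul_sum]
    rw [Finset.sum_comm]
    refine Finset.sum_congr rfl fun T _ => ?_
    simp only [mul_smul]
    rw [← Finset.smul_sum, ih, smul_comm]

/-! ### Boundary spins as basis wedges, and their coordinates -/

theorem boundarySpin_castSucc {ℓ M : ℕ} (part : Fin ℓ → ℕ) :
    (fun c : Fin M => boundarySpin (M + 1) part c.castSucc) = boundarySpin M part := rfl

/-- No sign appears because `wedge` puts the largest column first, as does a strictly decreasing
sequence. -/
theorem wedge_boundarySpin {ℓ M : ℕ} (part : Fin ℓ → ℕ) (hpart : StrictAnti part)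
    (hM : ∀ i, part i < M) :
    wedge R M (boundarySpin M part) =
      ExteriorAlgebra.ιMulti R ℓ fun i => Finsupp.single (part i) 1 := by
  induction M generalizing ℓ with
  | zero =>
    obtain rfl : ℓ = 0 := by
      by_contra hℓ
      exact absurd (hM ⟨0, Nat.pos_of_ne_zero hℓ⟩) (Nat.not_lt_zero _)
    simp [wedge]
  | succ M ih =>
    rw [wedge, boundarySpin_castSucc]
    by_cases h : ∃ i, part i = M
    · obtain ⟨i, hi⟩ := h
      obtain ⟨ℓ, rfl⟩ : ∃ k, ℓ = k + 1 := ⟨ℓ - 1, by have := i.2; omega⟩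
      have h0 : part 0 = M :=
        le_antisymm (Nat.lt_succ_iff.1 (hM 0)) (hi ▸ hpart.antitone (Fin.zero_le i))
      have hlt : ∀ j : Fin ℓ, part j.succ < M := fun j => h0 ▸ hpart (Fin.succ_pos j)
      have hb : boundarySpin M part = boundarySpin M fun j : Fin ℓ => part j.succ := by
        funext c
        simp [boundarySpin, Fin.exists_fin_succ, h0, c.2.ne']
      have hs : boundarySpin (M + 1) part (Fin.last M) = .minus :=
        if_pos ⟨0, by simpa using h0⟩
      rw [if_pos hs, hb, ih (fun j => part j.succ) (hpart.comp_strictMono Fin.strictMono_succ) hlt,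
        ExteriorAlgebra.ιMulti_succ_apply, h0]
      rfl
    · have hs : ¬ boundarySpin (M + 1) part (Fin.last M) = .minus := by
        simpa [boundarySpin] using h
      rw [if_neg hs, one_mul]
      exact ih part hpart fun i =>
        lt_of_le_of_ne (Nat.lt_succ_iff.1 (hM i)) fun hi => h ⟨i, hi⟩

theorem exists_eq_boundarySpin {M : ℕ} (S : Fin M → Spin) :
    ∃ (k : ℕ) (part : Fin k → ℕ), StrictAnti part ∧ (∀ i, part i < M) ∧
      S = boundarySpin M part := by
  let s : Finset (Fin M) := {c | S c = .minus}
  have hs : ∀ c, (∃ i, s.orderEmbOfFin rfl i = c) ↔ S c = .minus := fun c => by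
    rw [← Set.mem_range, s.range_orderEmbOfFin rfl]
    simp [s]
  refine ⟨s.card, fun i => s.orderEmbOfFin rfl i.rev, fun i j hij => ?_, fun i => Fin.isLt _, ?_⟩
  · exact (s.orderEmbOfFin rfl).strictMono (Fin.rev_lt_rev.2 hij)
  · funext c
    have : (∃ i : Fin s.card, ((s.orderEmbOfFin rfl i.rev : Fin M) : ℕ) = c) ↔ S c = .minus := by
      rw [← hs c, Fin.revPerm.surjective.exists]
      simp [Fin.ext_iff]
    unfold boundarySpin
    split_ifs with h
    · exact this.1 h
    · cases hc : S c
      · rfl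
      · exact absurd (this.2 hc) h

/-- The coordinates of alternating tensors at the columns `mu`. -/
noncomputable def minor (R : Type*) [CommRing R] {ℓ : ℕ} (mu : Fin ℓ → ℕ) :
    ExteriorAlgebra R (ℕ →₀ R) →ₗ[R] R :=
  ExteriorAlgebra.liftAlternating (R := R) (Pi.single ℓ
    ((Matrix.detRowAlternating (R := R) (n := Fin ℓ)).compLinearMap
      (LinearMap.pi fun j => Finsupp.lapply (mu j))))

theorem minor_ιMulti {ℓ : ℕ} (mu : Fin ℓ → ℕ) (v : Fin ℓ → ℕ →₀ R) :
    minor R mu (ExteriorAlgebra.ιMulti R ℓ v) = Matrix.det (Matrix.of fun i j => v i (mu j)) := by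
  rw [minor, ExteriorAlgebra.liftAlternating_apply_ιMulti, Pi.single_eq_same]
  rfl

theorem minor_ιMulti_of_ne {ℓ k : ℕ} (h : k ≠ ℓ) (mu : Fin ℓ → ℕ) (v : Fin k → ℕ →₀ R) :
    minor R mu (ExteriorAlgebra.ιMulti R k v) = 0 := by
  rw [minor, ExteriorAlgebra.liftAlternating_apply_ιMulti, Pi.single_eq_of_ne h]
  rfl

/-- This lets `minor R mu` extract a single partition function from the generating sum over top or
bottom spins. -/
theorem minor_wedge {ℓ M : ℕ} (mu : Fin ℓ → ℕ) (hmu : StrictAnti mu) (hM : ∀ i, mu i < M)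
    (S : Fin M → Spin) :
    minor R mu (wedge R M S) = if S = boundarySpin M mu then 1 else 0 := by
  split_ifs with h
  · have h1 : (Matrix.of fun i j => (Finsupp.single (mu i) (1 : R)) (mu j)) = 1 := by
      ext i j
      simp [Finsupp.single_apply, Matrix.one_apply, hmu.injective.eq_iff]
    rw [h, wedge_boundarySpin mu hmu hM, minor_ιMulti, h1, Matrix.det_one]
  · obtain ⟨k, part, hpart, hlt, rfl⟩ := exists_eq_boundarySpin S
    rw [wedge_boundarySpin part hpart hlt]
    by_cases hk : k = ℓ
    · subst hk
      rw [minor_ιMulti]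
      -- A part outside `mu` gives a zero row; otherwise, the lengths being equal, both sequences
      -- have the same set of parts.
      by_cases hsub : ∃ i, ∀ j, part i ≠ mu j
      · obtain ⟨i, hi⟩ := hsub
        exact Matrix.det_eq_zero_of_row_eq_zero i fun j => by simp [hi j]
      · push Not at hsub
        choose f hf using hsub
        have hinj : Function.Injective f := fun i j hij =>
          hpart.injective (by rw [hf, hf, hij])
        have hsurj := Finite.surjective_of_injective hinj
        refine absurd ?_ h
        funext c
        have : (∃ i, part i = (c : ℕ)) ↔ ∃ i, mu i = (c : ℕ) := by
          rw [hsurj.exists (p := fun i => mu i = (c : ℕ))]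
          simp only [hf]
        simp only [boundarySpin, this]
    · exact minor_ιMulti_of_ne hk _ _

/-! ### Determinant formula and translation to the two models -/

theorem partition_boundarySpin {N ℓ M : ℕ} (p : Fin N → FreeFermion R) (lam mu : Fin ℓ → ℕ)
    (hlam : StrictAnti lam) (hmu : StrictAnti mu) (hlamM : ∀ i, lam i < M)
    (hmuM : ∀ i, mu i < M) :
    partition p M (boundarySpin M lam) (boundarySpin M mu) = (∏ i, (p i).a) ^ M *
      Matrix.det (Matrix.of fun i j => transfers p (Finsupp.single (lam i) 1) (mu j)) := by
  have h := congrArg (minor R mu) (sum_partition_smul_wedge p M (boundarySpin M lam))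
  simpa [minor_wedge mu hmu hmuM, wedge_boundarySpin lam hlam hlamM,
    ExteriorAlgebra.map_apply_ιMulti, minor_ιMulti] using h

theorem partition_eq_det {N ℓ : ℕ} (p : Fin N → FreeFermion R)
    (lam mu : Fin ℓ → ℕ) (hlam : StrictAnti lam) (hmu : StrictAnti mu)
    (M : ℕ) (m : Fin ℓ → Fin ℓ → ℕ)
    (hm : ∀ i j, lam i < m i j ∧ mu j < m i j)
    (hM : ∀ σ : Equiv.Perm (Fin ℓ), M = ∑ i, m i (σ i)) :
    partition p M (boundarySpin M lam) (boundarySpin M mu) =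
      Matrix.det (Matrix.of fun i j : Fin ℓ =>
        partition p (m i j) (boundarySpin (m i j) ![lam i]) (boundarySpin (m i j) ![mu j])) := by
  have hle : ∀ i j, m i j ≤ M := fun i j => by
    -- The transposition sends `i` to `j`, so `m i j` is one summand of `M`.
    rw [hM (Equiv.swap i j)]
    simpa using Finset.single_le_sum (f := fun k => m k (Equiv.swap i j k))
      (fun _ _ => Nat.zero_le _) (Finset.mem_univ i)
  rw [partition_boundarySpin p lam mu hlam hmu (fun i => (hm i i).1.trans_le (hle i i))
    fun i => (hm i i).2.trans_le (hle i i)]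
  have hentry : ∀ i j, partition p (m i j) (boundarySpin (m i j) ![lam i])
      (boundarySpin (m i j) ![mu j]) =
      (∏ k, (p k).a) ^ m i j * transfers p (Finsupp.single (lam i) 1) (mu j) := fun i j => by
    rw [partition_boundarySpin p _ _ (Subsingleton.strictAnti _) (Subsingleton.strictAnti _)
      (by simpa using (hm i j).1) (by simpa using (hm i j).2)]
    simp
  simp only [hentry]
  -- `Matrix.det_apply` uses the entries `(σ i, i)`, while `hM` concerns `(i, σ i)`.
  rw [← Matrix.det_transpose, ← Matrix.det_transpose (Matrix.of _), Matrix.det_apply,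
    Matrix.det_apply, Finset.mul_sum]
  refine Finset.sum_congr rfl fun σ _ => ?_
  simp only [Matrix.transpose_apply, Matrix.of_apply, Finset.prod_mul_distrib,
    Finset.prod_pow_eq_pow_sum, ← hM σ, mul_smul_comm]

theorem partition_eq_sum_config {N M ℓ k : ℕ} (p : Fin N → FreeFermion R)
    (lam : Fin ℓ → ℕ) (mu : Fin k → ℕ) :
    partition p M (boundarySpin M lam) (boundarySpin M mu) =
      ∑ s : Config N M with HasBoundary lam mu s, ∏ i : Fin N, ∏ c : Fin M,
        (p i).vertex (s.2 i c.castSucc) (s.1 i.castSucc c) (s.2 i c.succ) (s.1 i.succ c) := by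
  rw [Finset.sum_filter, Fintype.sum_prod_type, partition]
  refine Finset.sum_congr rfl fun v _ => ?_
  simp only [FreeFermion.row, HasBoundary, ← and_assoc, ite_and (_ ∧ _)]
  split_ifs
  · rw [Finset.prod_univ_sum, Fintype.piFinset_univ]
    refine Finset.sum_congr rfl fun g _ => ?_
    rw [Finset.prod_ite_zero]
    simp
  · simp

end SixVertex

theorem mainTheorem9 {R : Type*} [CommRing R] {N ℓ : ℕ} (x y : Fin N → R)
    (lam mu : Fin ℓ → ℕ) (hlam : StrictAnti lam) (hmu : StrictAnti mu)
    (M : ℕ) (m : Fin ℓ → Fin ℓ → ℕ)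
    (hm : ∀ i j, lam i < m i j ∧ mu j < m i j)
    (hM : ∀ σ : Equiv.Perm (Fin ℓ), M = ∑ i, m i (σ i)) :
    (∀ A B : Fin N → R,
      SixVertex.Z x y A B M lam mu =
        Matrix.det (Matrix.of fun i j : Fin ℓ =>
          SixVertex.Z x y A B (m i j) ![lam i] ![mu j])) ∧
    (∀ A B : Fin N → Rˣ,
      SixVertex.ZStar x y A B M lam mu =
        Matrix.det (Matrix.of fun i j : Fin ℓ =>
          SixVertex.ZStar x y A B (m i j) ![lam i] ![mu j])) := by
  constructor
  · intro A B
    have h := SixVertex.partition_eq_det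
      -- Here `c₁ c₂ - b₁ b₂ = y B`. Rows run upwards, so the incoming edge is the south one.
      (fun i => ⟨A i, B i, x i, (x i + y i) * B i, 1⟩) lam mu hlam hmu M m hm hM
    have hw : ∀ i w n e s, SixVertex.weight (x i) (y i) (A i) (B i) w n e s =
        SixVertex.FreeFermion.vertex ⟨A i, B i, x i, (x i + y i) * B i, 1⟩ w s e n := by
      intro i w n e s
      cases w <;> cases n <;> cases e <;> cases s <;>
        simp only [SixVertex.weight, SixVertex.FreeFermion.vertex] <;> ring
    simpa only [SixVertex.partition_eq_sum_config, SixVertex.Z, hw] using h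
  · intro A B
    have h := SixVertex.partition_eq_det
      -- Here `c₁ c₂ - b₁ b₂ = x B⁻¹`, and the incoming edge is the north one.
      (fun i => ⟨↑(A i)⁻¹, ↑(B i)⁻¹, y i, ↑(B i)⁻¹, x i + y i⟩) lam mu hlam hmu M m hm hM
    have hw : ∀ i w n e s, SixVertex.weightStar (x i) (y i) (A i) (B i) w n e s =
        SixVertex.FreeFermion.vertex
          (⟨↑(A i)⁻¹, ↑(B i)⁻¹, y i, ↑(B i)⁻¹, x i + y i⟩ : SixVertex.FreeFermion R) w n e s := by
      intro i w n e s
      cases w <;> cases n <;> cases e <;> cases s <;>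
        simp only [SixVertex.weightStar, SixVertex.FreeFermion.vertex] <;> ring
    simpa only [SixVertex.partition_eq_sum_config, SixVertex.ZStar, hw] using h
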